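/- Let $M$ be an oriented $n$-dimensional smooth manifold with a (pseudo-)Riemannian metric $g$, let $\eta$ be its metric volume element, let $\Lambda=\bigoplus_a\Lambda^a$ be the algebra of smooth differential forms with the exterior product $\wedge$, and let $d$ be the exterior derivative. Let $\ast\alpha=(\eta,\alpha)$ be the Hodge operator, i.e. the contraction of $\alpha$, with indices raised by $g$, with the last $a$ indices of $\eta$ (divided by $a!$) for an $a$-form $\alpha$; let $\epsilon=\ast\eta=\pm1$ be the sign of $\det g$, let $\delta=\epsilon(-1)^{na}\ast d\,\ast$ on $a$-forms be the codifferential, and let $\Delta=d\delta+\delta d$ be the Laplacian. For an operation $\circ$ of degree $k$ on $\Lambda$ (that is, $\Lambda^a\circ\Lambda^b\subseteq\Lambda^{a+b+k}$) and an operator $P$ of degree $p$, the Leibniz bracket of $P$ with respect to $\circ$ is the operation of degree $p+k$ $$\mathcal L_P\langle\circ\rangle(\alpha,\beta)=\alpha\circ P\beta+(-1)^{p(a+k)}\bigl[P\alpha\circ\beta-P(\alpha\circ\beta)\bigr],\qquad \alpha\in\Lambda^a,\ \beta\in\Lambda .$$ Let $\{\ ,\ \}_\delta=\mathcal L_\delta\langle\wedge\rangle$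 be the Leibniz–Schouten bracket (of degree $-1$), and for $\alpha\in\Lambda^a$ let $$\{\alpha,\beta\}=(-1)^a\{\alpha,\beta\}_\delta=\delta\alpha\wedge\beta+(-1)^a\alpha\wedge\delta\beta-\delta(\alpha\wedge\beta).$$ **Theorem 4.** The Leibniz bracket of the Laplacian on the exterior algebra equals the Leibniz bracket of the exterior derivative on the Leibniz–Schouten algebra: $$\mathcal L_\Delta\langle\wedge\rangle=\mathcal L_d\langle\{\ ,\ \}_\delta\rangle .$$ Explicitly, for every smooth $a$-form $\alpha$ and every smooth form $\beta$, $$\Delta\alpha\wedge\beta+\alpha\wedge\Delta\beta-\Delta(\alpha\wedge\beta)=\{d\alpha,\beta\}+(-1)^a\{\alpha,d\beta\}+d\{\alpha,\beta\}.$$ -/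

import Mathlib

open scoped Manifold ContDiff

noncomputable section

namespace LeibnizLaplacian

/-! ## Leibniz brackets on graded groups

A graded binary operation on a graded group `E = ⨁ E_a` is recorded by its restrictions
`op a : E_a × E → E` to left arguments that are homogeneous of degree `a`. -/

/-- The Leibniz bracket of an operator `P` of degree `p` with respect to an operation `op` of
degree `k`: for `A` homogeneous of degree `a`,
`L_P⟨∘⟩(A, B) = A ∘ P B + (-1)^(p (a + k)) (P A ∘ B - P (A ∘ B))`. -/
def leibnizBracket {E : Type*} [AddCommGroup E] (p k : ℤ) (P : E → E) (op : ℤ → E → E → E) :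
    ℤ → E → E → E :=
  fun a A B => op a A (P B) + (p * (a + k)).negOnePow • (op (a + p) (P A) B - P (op a A B))

/-! ## Exterior algebra at a point -/

section Pointwise

variable (V : Type*) [AddCommGroup V] [Module ℝ V]

/-- The exterior covariant algebra of `V`: the exterior algebra of the dual space. -/
abbrev Cov : Type _ := ExteriorAlgebra ℝ (Module.Dual ℝ V)

/-- The interior product `(β, A)` of a covariant `β` with a contravariant `A`, in which `A` fills
the last slots of `β`; written `contraction V A β`. It is determined by
`(β, X) = β(·, …, ·, X)` for a vector `X` and `(β, A ∧ B) = ((β, B), A)`. -/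
def contraction : ExteriorAlgebra ℝ V →ₐ[ℝ] Module.End ℝ (Cov V) :=
  ExteriorAlgebra.lift ℝ
    ⟨(CliffordAlgebra.contractRight
        (Q := (0 : QuadraticForm ℝ (Module.Dual ℝ V)))).flip ∘ₗ Module.Dual.eval ℝ V,
      fun X => LinearMap.ext fun β =>
        CliffordAlgebra.contractRight_contractRight
          (Q := (0 : QuadraticForm ℝ (Module.Dual ℝ V))) (d := Module.Dual.eval ℝ V X) β⟩

variable {V} [FiniteDimensional ℝ V]

/-- Index raising on covariant multivectors, by a nondegenerate bilinear form `B`. -/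
def raise (B : LinearMap.BilinForm ℝ V) (hB : B.Nondegenerate) :
    Cov V →ₐ[ℝ] ExteriorAlgebra ℝ V :=
  ExteriorAlgebra.map (B.toDual hB).symm.toLinearMap

/-- The Hodge operator `∗α = (η, α^♯)` of the metric `B` and the volume element `η`. -/
def hodgeStar (B : LinearMap.BilinForm ℝ V) (hB : B.Nondegenerate) (η : Cov V) :
    Cov V →ₗ[ℝ] Cov V :=
  (contraction V).toLinearMap.flip η ∘ₗ (raise B hB).toLinearMap

end Pointwise

/-! ## Differential forms on (an open subset of) `ℝⁿ` -/

/-- The coordinate covectors `dxⁱ`. -/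
def dxBasis (n : ℕ) : Module.Basis (Fin n) ℝ (Module.Dual ℝ (EuclideanSpace ℝ (Fin n))) :=
  (EuclideanSpace.basisFun (Fin n) ℝ).toBasis.dualBasis

/-- The basis `dx^I`, `I ⊆ {1, …, n}`, of the exterior algebra. -/
def dxBasisExt (n : ℕ) : Module.Basis (Finset (Fin n)) ℝ (Cov (EuclideanSpace ℝ (Fin n))) :=
  (dxBasis n).ExteriorAlgebra

/-- The component `w_I` of a form `w = ∑ w_I dx^I` on `ℝⁿ`. -/
def component {n : ℕ} (w : EuclideanSpace ℝ (Fin n) → Cov (EuclideanSpace ℝ (Fin n)))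
    (I : Finset (Fin n)) (y : EuclideanSpace ℝ (Fin n)) : ℝ :=
  (dxBasisExt n).repr (w y) I

/-- The exterior derivative on `ℝⁿ`: `d(∑ w_I dx^I) = ∑_I ∑_i (∂w_I/∂xⁱ) dxⁱ ∧ dx^I`. -/
def extDerivEuc {n : ℕ} (w : EuclideanSpace ℝ (Fin n) → Cov (EuclideanSpace ℝ (Fin n)))
    (y : EuclideanSpace ℝ (Fin n)) : Cov (EuclideanSpace ℝ (Fin n)) :=
  ∑ I : Finset (Fin n), ∑ i : Fin n,
    fderiv ℝ (component w I) y (EuclideanSpace.single i 1) •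
      (ExteriorAlgebra.ι ℝ (dxBasis n i) * dxBasisExt n I)

/-! ## Differential forms on a manifold -/

section Manifold

variable (n : ℕ) (M : Type*) [TopologicalSpace M] [ChartedSpace (EuclideanSpace ℝ (Fin n)) M]

instance (x : M) : FiniteDimensional ℝ (TangentSpace (𝓡 n) x) :=
  inferInstanceAs (FiniteDimensional ℝ (EuclideanSpace ℝ (Fin n)))

/-- The (not necessarily smooth, not necessarily homogeneous) differential forms on `M`: sections
of the exterior algebra of the cotangent spaces. Sums are pointwise, and the exterior product is
the pointwise product. -/
abbrev Form : Type _ := ∀ x : M, Cov (TangentSpace (𝓡 n) x)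

variable {n M}

/-- The coordinate frame of the chart at `x₀`: the derivative of the inverse chart at `y`. -/
def frame (x₀ : M) (y : EuclideanSpace ℝ (Fin n)) :
    EuclideanSpace ℝ (Fin n) →ₗ[ℝ] TangentSpace (𝓡 n) ((extChartAt (𝓡 n) x₀).symm y) :=
  (mfderiv (𝓡 n) (𝓡 n) (extChartAt (𝓡 n) x₀).symm y).toLinearMap

/-- The coframe of the chart at `x`, at the point `x` itself: the derivative of the chart. -/
def coframe (x : M) : TangentSpace (𝓡 n) x →ₗ[ℝ] EuclideanSpace ℝ (Fin n) :=
  (mfderiv (𝓡 n) (𝓡 n) (extChartAt (𝓡 n) x) x).toLinearMap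

/-- The coordinate expression of a form in the chart at `x₀`: its pullback under the inverse
chart. Only its values on the target of the chart are meaningful. -/
def chartRep (α : Form n M) (x₀ : M) (y : EuclideanSpace ℝ (Fin n)) :
    Cov (EuclideanSpace ℝ (Fin n)) :=
  ExteriorAlgebra.map (frame x₀ y).dualMap (α ((extChartAt (𝓡 n) x₀).symm y))

/-- Smoothness of a form: its components in the charts are smooth. -/
def Form.IsSmooth (α : Form n M) : Prop :=
  ∀ (x₀ : M) (I : Finset (Fin n)),
    ContDiffOn ℝ ∞ (component (chartRep α x₀) I) (extChartAt (𝓡 n) x₀).target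

/-- `α` is homogeneous of degree `a`. -/
def Form.IsOfDegree (α : Form n M) (a : ℕ) : Prop :=
  ∀ x : M, α x ∈ ⋀[ℝ]^a (Module.Dual ℝ (TangentSpace (𝓡 n) x))

/-- The exterior derivative, computed at `x` in the chart at `x`. -/
def extD (α : Form n M) : Form n M :=
  fun x => ExteriorAlgebra.map (coframe x).dualMap
    (extDerivEuc (chartRep α x) (extChartAt (𝓡 n) x x))

variable (n M) in
/-- A smooth pseudo-Riemannian metric. -/
structure PseudoRiemannianMetric where
  /-- the bilinear form on each tangent space -/
  val : ∀ x : M, LinearMap.BilinForm ℝ (TangentSpace (𝓡 n) x)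
  symm : ∀ x, (val x).IsSymm
  nondegenerate : ∀ x, (val x).Nondegenerate
  smooth : ∀ (x₀ : M) (v w : EuclideanSpace ℝ (Fin n)),
    ContDiffOn ℝ ∞
      (fun y => val ((extChartAt (𝓡 n) x₀).symm y) (frame x₀ y v) (frame x₀ y w))
      (extChartAt (𝓡 n) x₀).target

/-- The Hodge operator on forms. -/
def PseudoRiemannianMetric.star (g : PseudoRiemannianMetric n M) (η α : Form n M) : Form n M :=
  fun x => hodgeStar (g.val x) (g.nondegenerate x) (η x) (α x)

/-- A metric volume element of `(M, g)`: a smooth `n`-form `η` whose full contraction with itself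
(indices raised by `g`, divided by `n!`), namely `∗η`, is `1` or `-1` at each point. It fixes the
orientation of `M` and is the Riemannian volume form of the oriented manifold `(M, g)`. -/
structure VolumeElement (g : PseudoRiemannianMetric n M) where
  /-- the `n`-form -/
  form : Form n M
  smooth : form.IsSmooth
  degree : form.IsOfDegree n
  normalized : ∀ x, g.star form form x = 1 ∨ g.star form form x = -1

variable {g : PseudoRiemannianMetric n M} (η : VolumeElement g)

/-- The sign `ε = ±1` with `∗η = ε`; it is the sign of `det g`. -/
def VolumeElement.sign (x : M) : ℝ := ExteriorAlgebra.algebraMapInv (g.star η.form η.form x)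

/-- The codifferential `δ = ε (-1)^(n a) ∗ d ∗` on `a`-forms, extended additively to all forms
(`involute` is multiplication by `(-1)^a` on the component of degree `a`). -/
def codiff (α : Form n M) : Form n M :=
  fun x => η.sign x •
    g.star η.form (extD (g.star η.form fun z => CliffordAlgebra.involute^[n] (α z))) x

/-- The Hodge Laplacian `Δ = dδ + δd`. -/
def laplacian (α : Form n M) : Form n M :=
  extD (codiff η α) + codiff η (extD α)

variable (n M) in
/-- The exterior product, as a graded operation (of degree `0`). -/
def wedge : ℤ → Form n M → Form n M → Form n M := fun _ α β => α * β

/-- The Leibniz–Schouten bracket `{α, β}_δ`: the Leibniz bracket of the operator `δ` of degree `-1`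
on the exterior algebra. It is an operation of degree `-1`. -/
def leibnizSchouten : ℤ → Form n M → Form n M → Form n M :=
  leibnizBracket (-1) 0 (codiff η) (wedge n M)

/-- The Schouten bracket `{α, β} = (-1)^a {α, β}_δ = δα ∧ β + (-1)^a α ∧ δβ - δ(α ∧ β)` of an
`a`-form `α` with `β`. -/
def schouten (a : ℤ) (α β : Form n M) : Form n M := a.negOnePow • leibnizSchouten η a α β

end Manifold

end LeibnizLaplacian

end

noncomputable section

/-! Since `Δ = dδ + δd` and `d` is an odd derivation of the wedge product, only the failure of `δ`
to be a derivation contributes to the defect of `Δ`. Expanding the three Schouten terms with the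
graded Leibniz rule, the mixed products `dα ∧ δβ` and `δα ∧ dβ` each occur twice with opposite
signs, and the rest assembles into `Δ`. Neither `d² = 0` nor `δ² = 0` is needed. This computation is
`laplacian_mul_defect`.

Its inputs are the Leibniz rule `extD_mul`, linearity of `d` and `δ`, and the odd parity of `δ`
(`involForm_codiff`). All signs are carried by the grade involution, so the degree of `δα` is needed
only modulo 2.

The analytic work lies in making `d` and `δ` operators on smooth forms. Because `extD` uses a
different chart at each point, `chartRep_extD` rewrites it in one fixed chart, through naturality of
`d` under pullback (`extDerivEuc_pullback`). Smoothness of `δα` rests on `contDiffOn_hodgeStar`,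
where index raising is smooth because operator inversion is. -/

namespace LeibnizLaplacian

/-! ### Exterior algebra: grade involution, contraction and naturality of the Hodge operator. -/

section Algebra

variable {V W : Type*} [AddCommGroup V] [Module ℝ V] [AddCommGroup W] [Module ℝ W]

/-- Grade involution on the exterior algebra. -/
abbrev invol (V : Type*) [AddCommGroup V] [Module ℝ V] :
    ExteriorAlgebra ℝ V →ₐ[ℝ] ExteriorAlgebra ℝ V :=
  CliffordAlgebra.involute

theorem invol_ι (v : V) : invol V (ExteriorAlgebra.ι ℝ v) = -ExteriorAlgebra.ι ℝ v :=
  CliffordAlgebra.involute_ι v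

/-- Each vector factor of `u` that `v` crosses costs one sign. This is the origin of the sign in the
graded Leibniz rule. -/
theorem ι_mul_eq_invol_mul_ι (v : V) (u : ExteriorAlgebra ℝ V) :
    ExteriorAlgebra.ι ℝ v * u = invol V u * ExteriorAlgebra.ι ℝ v := by
  induction u using ExteriorAlgebra.induction with
  | algebraMap r => rw [AlgHom.commutes, Algebra.commutes]
  | ι x =>
    rw [invol_ι, neg_mul, eq_neg_iff_add_eq_zero]
    exact ExteriorAlgebra.ι_add_mul_swap v x
  | mul a b ha hb => rw [map_mul, ← mul_assoc, ha, mul_assoc, hb, mul_assoc]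
  | add a b ha hb => rw [map_add, mul_add, ha, hb, add_mul]

theorem invol_map (f : V →ₗ[ℝ] W) (u : ExteriorAlgebra ℝ V) :
    invol W (ExteriorAlgebra.map f u) = ExteriorAlgebra.map f (invol V u) := by
  have : (invol W).comp (ExteriorAlgebra.map f) = (ExteriorAlgebra.map f).comp (invol V) := by
    ext x
    simp [CliffordAlgebra.involute_ι]
  exact DFunLike.congr_fun this u

theorem invol_of_mem {a : ℕ} {u : ExteriorAlgebra ℝ V} (hu : u ∈ ⋀[ℝ]^a V) :
    invol V u = (-1 : ℝ) ^ a • u := by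
  rw [← ExteriorAlgebra.ιMulti_span_fixedDegree] at hu
  induction hu using Submodule.span_induction with
  | mem x hx =>
    obtain ⟨v, rfl⟩ := hx
    rw [ExteriorAlgebra.ιMulti_apply]
    have := CliffordAlgebra.involute_prod_map_ι (Q := (0 : QuadraticForm ℝ V)) (List.ofFn v)
    rw [List.map_ofFn, List.length_ofFn] at this
    exact this
  | zero => simp
  | add x y _ _ hx hy => rw [map_add, hx, hy, smul_add]
  | smul r x _ hx => rw [map_smul, hx, smul_comm]

theorem algebraMapInv_map (f : V →ₗ[ℝ] W) (u : ExteriorAlgebra ℝ V) :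
    ExteriorAlgebra.algebraMapInv (ExteriorAlgebra.map f u) =
      ExteriorAlgebra.algebraMapInv u := by
  have : (ExteriorAlgebra.algebraMapInv).comp (ExteriorAlgebra.map f) =
      (ExteriorAlgebra.algebraMapInv : ExteriorAlgebra ℝ V →ₐ[ℝ] ℝ) := by
    ext x
    simp [ExteriorAlgebra.algebraMapInv]
  exact DFunLike.congr_fun this u

theorem map_map (f : V →ₗ[ℝ] W) {X : Type*} [AddCommGroup X] [Module ℝ X] (g : W →ₗ[ℝ] X)
    (u : ExteriorAlgebra ℝ V) :
    ExteriorAlgebra.map g (ExteriorAlgebra.map f u) = ExteriorAlgebra.map (g ∘ₗ f) u :=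
  DFunLike.congr_fun (ExteriorAlgebra.map_comp_map f g) u

/-- Together with vanishing on scalars this recursion determines contraction with a vector, hence
the inductions by right multiplication. -/
theorem contraction_ι_mul_ι (X : V) (u : Cov V) (l : Module.Dual ℝ V) :
    contraction V (ExteriorAlgebra.ι ℝ X) (u * ExteriorAlgebra.ι ℝ l) =
      l X • u - contraction V (ExteriorAlgebra.ι ℝ X) u * ExteriorAlgebra.ι ℝ l := by
  simp only [contraction, ExteriorAlgebra.lift_ι_apply]
  exact CliffordAlgebra.contractRight_mul_ι _ l u

theorem contraction_ι_algebraMap (X : V) (r : ℝ) :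
    contraction V (ExteriorAlgebra.ι ℝ X) (algebraMap ℝ _ r) = 0 := by
  simp only [contraction, ExteriorAlgebra.lift_ι_apply]
  exact CliffordAlgebra.contractRight_algebraMap (Q := 0) _ r

/-- Induction on an exterior algebra by right multiplication with vectors. -/
theorem induction_mul_ι {P : ExteriorAlgebra ℝ V → Prop}
    (algebraMap : ∀ r : ℝ, P (algebraMap ℝ _ r)) (add : ∀ u v, P u → P v → P (u + v))
    (mul_ι : ∀ u x, P u → P (u * ExteriorAlgebra.ι ℝ x)) (u : ExteriorAlgebra ℝ V) : P u :=
  CliffordAlgebra.right_induction (Q := (0 : QuadraticForm ℝ V)) algebraMap add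
    (fun x u h => mul_ι u x h) u

theorem contraction_ι_map (f : V →ₗ[ℝ] W) (X : V) (u : Cov W) :
    ExteriorAlgebra.map f.dualMap (contraction W (ExteriorAlgebra.ι ℝ (f X)) u) =
      contraction V (ExteriorAlgebra.ι ℝ X) (ExteriorAlgebra.map f.dualMap u) := by
  induction u using induction_mul_ι with
  | algebraMap r =>
    rw [AlgHom.commutes, contraction_ι_algebraMap, contraction_ι_algebraMap, map_zero]
  | add a b ha hb => simp only [map_add, ha, hb]
  | mul_ι u l h =>
    rw [map_mul (ExteriorAlgebra.map _), ExteriorAlgebra.map_apply_ι, contraction_ι_mul_ι,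
      contraction_ι_mul_ι, map_sub,
      map_mul, map_smul, h, ExteriorAlgebra.map_apply_ι, LinearMap.dualMap_apply]

/-- Contraction is multiplicative in `A`, with product going to composition, so the case of a single
vector suffices once `u` is allowed to vary. -/
theorem contraction_map (f : V →ₗ[ℝ] W) (A : ExteriorAlgebra ℝ V) (u : Cov W) :
    ExteriorAlgebra.map f.dualMap (contraction W (ExteriorAlgebra.map f A) u) =
      contraction V A (ExteriorAlgebra.map f.dualMap u) := by
  induction A using ExteriorAlgebra.induction generalizing u with
  | algebraMap r => simp only [AlgHom.commutes, Module.algebraMap_end_apply, map_smul]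
  | ι x => rw [ExteriorAlgebra.map_apply_ι, contraction_ι_map]
  | mul a b ha hb => rw [map_mul, map_mul, map_mul, Module.End.mul_apply, Module.End.mul_apply,
      ha, hb]
  | add a b ha hb => simp only [map_add, LinearMap.add_apply, ha, hb]

theorem invol_contraction_ι (X : V) (u : Cov V) :
    invol _ (contraction V (ExteriorAlgebra.ι ℝ X) u) =
      -contraction V (ExteriorAlgebra.ι ℝ X) (invol _ u) := by
  induction u using induction_mul_ι with
  | algebraMap r => rw [AlgHom.commutes, contraction_ι_algebraMap, map_zero, neg_zero]
  | add a b ha hb => simp only [map_add, ha, hb, neg_add]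
  | mul_ι u l h =>
    rw [map_mul (invol _), invol_ι, contraction_ι_mul_ι, map_sub, map_mul, map_smul, h, invol_ι, mul_neg,
      mul_neg, map_neg, contraction_ι_mul_ι, neg_mul, neg_neg, neg_neg]

theorem invol_contraction (A : ExteriorAlgebra ℝ V) (u : Cov V) :
    invol _ (contraction V A u) = contraction V (invol V A) (invol _ u) := by
  induction A using ExteriorAlgebra.induction generalizing u with
  | algebraMap r => simp only [AlgHom.commutes, Module.algebraMap_end_apply, map_smul]
  | ι x => rw [invol_contraction_ι, invol_ι, map_neg, LinearMap.neg_apply]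
  | mul a b ha hb => rw [map_mul, map_mul, map_mul, Module.End.mul_apply, Module.End.mul_apply,
      ha, hb]
  | add a b ha hb => simp only [map_add, LinearMap.add_apply, ha, hb]

theorem hodgeStar_apply [FiniteDimensional ℝ V] (B : LinearMap.BilinForm ℝ V)
    (hB : B.Nondegenerate) (η u : Cov V) :
    hodgeStar B hB η u = contraction V (raise B hB u) η := rfl

theorem invol_hodgeStar [FiniteDimensional ℝ V] (B : LinearMap.BilinForm ℝ V)
    (hB : B.Nondegenerate) (η u : Cov V) :
    invol _ (hodgeStar B hB η u) = hodgeStar B hB (invol _ η) (invol _ u) := by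
  rw [hodgeStar_apply, hodgeStar_apply, invol_contraction, raise, invol_map]

/-- Pullback by an isometry respects both contraction and index raising. This allows the Hodge
operator to be computed in coordinates. -/
theorem hodgeStar_map [FiniteDimensional ℝ V] [FiniteDimensional ℝ W] (f : V ≃ₗ[ℝ] W)
    (B : LinearMap.BilinForm ℝ W) (hB : B.Nondegenerate) (G : LinearMap.BilinForm ℝ V)
    (hG : G.Nondegenerate) (h : ∀ v w, G v w = B (f v) (f w)) (η u : Cov W) :
    ExteriorAlgebra.map f.toLinearMap.dualMap (hodgeStar B hB η u) =
      hodgeStar G hG (ExteriorAlgebra.map f.toLinearMap.dualMap η)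
        (ExteriorAlgebra.map f.toLinearMap.dualMap u) := by
  have hr : raise B hB u = ExteriorAlgebra.map f.toLinearMap
      (raise G hG (ExteriorAlgebra.map f.toLinearMap.dualMap u)) := by
    rw [raise, raise, map_map, map_map]
    congr 2
    ext l : 1
    -- Raising is the inverse of lowering, so the two raised vectors are compared after lowering.
    apply (B.toDual hB).injective
    ext w
    obtain ⟨v, rfl⟩ := f.surjective w
    simp only [LinearMap.comp_apply, LinearEquiv.coe_coe, LinearEquiv.apply_symm_apply,
      LinearMap.BilinForm.toDual_def]
    rw [← h, LinearMap.BilinForm.apply_toDual_symm_apply]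
    rfl
  rw [hodgeStar_apply, hodgeStar_apply, hr, contraction_map]

end Algebra


/-! ### Calculus of exterior-algebra-valued functions on Euclidean space. -/

section Calculus

instance (X : Type*) [AddCommGroup X] [Module ℝ X] [FiniteDimensional ℝ X] :
    FiniteDimensional ℝ (ExteriorAlgebra ℝ X) :=
  (Module.finBasis ℝ X).ExteriorAlgebra.finiteDimensional_of_finite

/-- A norm on the exterior algebra of a finite dimensional space (the topology does not depend on
the choice). -/
abbrev extNorm (X : Type*) [AddCommGroup X] [Module ℝ X] [FiniteDimensional ℝ X] :
    NormedAddCommGroup (ExteriorAlgebra ℝ X) :=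
  NormedAddCommGroup.induced _ _ (Module.finBasis ℝ (ExteriorAlgebra ℝ X)).equivFun.toLinearMap
    (Module.finBasis ℝ (ExteriorAlgebra ℝ X)).equivFun.injective

attribute [local instance] extNorm

/-- The normed space structure for `extNorm`. -/
abbrev extNormedSpace (X : Type*) [AddCommGroup X] [Module ℝ X] [FiniteDimensional ℝ X] :
    NormedSpace ℝ (ExteriorAlgebra ℝ X) :=
  NormedSpace.induced ℝ _ _ (Module.finBasis ℝ (ExteriorAlgebra ℝ X)).equivFun.toLinearMap

attribute [local instance] extNormedSpace

variable {n : ℕ}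

local notation "𝔼" => EuclideanSpace ℝ (Fin n)

theorem contDiffOn_bilinear {k : WithTop ℕ∞} {E A B C : Type*} [NormedAddCommGroup E]
    [NormedSpace ℝ E] [NormedAddCommGroup A] [NormedSpace ℝ A] [FiniteDimensional ℝ A]
    [NormedAddCommGroup B] [NormedSpace ℝ B] [FiniteDimensional ℝ B] [NormedAddCommGroup C]
    [NormedSpace ℝ C] (T : A →ₗ[ℝ] B →ₗ[ℝ] C) {f : E → A} {g : E → B} {s : Set E}
    (hf : ContDiffOn ℝ k f s) (hg : ContDiffOn ℝ k g s) :
    ContDiffOn ℝ k (fun y => T (f y) (g y)) s :=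
  (T.toContinuousBilinearMap.isBoundedBilinearMap.contDiff).comp_contDiffOn (hf.prodMk hg)

theorem contDiffOn_linear {k : WithTop ℕ∞} {E A C : Type*} [NormedAddCommGroup E]
    [NormedSpace ℝ E] [NormedAddCommGroup A] [NormedSpace ℝ A] [FiniteDimensional ℝ A]
    [NormedAddCommGroup C] [NormedSpace ℝ C] (T : A →ₗ[ℝ] C) {f : E → A} {s : Set E}
    (hf : ContDiffOn ℝ k f s) : ContDiffOn ℝ k (fun y => T (f y)) s :=
  (LinearMap.toContinuousLinearMap T).contDiff.comp_contDiffOn hf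

theorem contDiffOn_extMul {k : WithTop ℕ∞} {E X : Type*} [NormedAddCommGroup E]
    [NormedSpace ℝ E] [AddCommGroup X] [Module ℝ X] [FiniteDimensional ℝ X]
    {f g : E → ExteriorAlgebra ℝ X} {s : Set E}
    (hf : ContDiffOn ℝ k f s) (hg : ContDiffOn ℝ k g s) :
    ContDiffOn ℝ k (fun y => f y * g y) s :=
  contDiffOn_bilinear (LinearMap.mul ℝ (ExteriorAlgebra ℝ X)) hf hg

/-- Smoothness of `f` is phrased through `ι` because only the exterior algebra of `Y`, not `Y`
itself, carries a norm here. -/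
theorem contDiffOn_map_const {k : WithTop ℕ∞} {E X Y : Type*} [NormedAddCommGroup E]
    [NormedSpace ℝ E] [AddCommGroup X] [Module ℝ X] [AddCommGroup Y]
    [Module ℝ Y] [FiniteDimensional ℝ Y] {f : E → X →ₗ[ℝ] Y} {s : Set E}
    (hf : ∀ v, ContDiffOn ℝ k (fun y => ExteriorAlgebra.ι ℝ (f y v)) s)
    (u : ExteriorAlgebra ℝ X) :
    ContDiffOn ℝ k (fun y => ExteriorAlgebra.map (f y) u) s := by
  induction u using ExteriorAlgebra.induction with
  | algebraMap r => simp only [AlgHom.commutes]; exact contDiffOn_const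
  | ι x => simpa only [ExteriorAlgebra.map_apply_ι] using hf x
  | mul a b ha hb => simp only [map_mul]; exact contDiffOn_extMul ha hb
  | add a b ha hb => simp only [map_add]; exact ha.add hb

theorem contDiffOn_map {k : WithTop ℕ∞} {E X Y : Type*} [NormedAddCommGroup E]
    [NormedSpace ℝ E] [AddCommGroup X] [Module ℝ X] [FiniteDimensional ℝ X] [AddCommGroup Y]
    [Module ℝ Y] [FiniteDimensional ℝ Y] {f : E → X →ₗ[ℝ] Y} {s : Set E}
    (hf : ∀ v, ContDiffOn ℝ k (fun y => ExteriorAlgebra.ι ℝ (f y v)) s)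
    {w : E → ExteriorAlgebra ℝ X} (hw : ContDiffOn ℝ k w s) :
    ContDiffOn ℝ k (fun y => ExteriorAlgebra.map (f y) (w y)) s := by
  let b := Module.finBasis ℝ (ExteriorAlgebra ℝ X)
  have h : ∀ y, ExteriorAlgebra.map (f y) (w y) =
      ∑ i, b.coord i (w y) • ExteriorAlgebra.map (f y) (b i) := by
    intro y
    conv_lhs => rw [← b.sum_repr (w y)]
    simp only [map_sum, map_smul, Module.Basis.coord_apply]
  simp only [h]
  exact ContDiffOn.sum fun i _ =>
    (contDiffOn_linear (b.coord i) hw).smul (contDiffOn_map_const hf (b i))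

/-- `∑ᵢ dxⁱ ∧ L eᵢ`. -/
def wedgeTrace (n : ℕ) : (EuclideanSpace ℝ (Fin n) →L[ℝ] Cov (EuclideanSpace ℝ (Fin n))) →ₗ[ℝ]
    Cov (EuclideanSpace ℝ (Fin n)) :=
  ∑ i : Fin n, LinearMap.mulLeft ℝ (ExteriorAlgebra.ι ℝ (dxBasis n i)) ∘ₗ
    (ContinuousLinearMap.apply ℝ (Cov (EuclideanSpace ℝ (Fin n)))
      (EuclideanSpace.single i (1 : ℝ))).toLinearMap

theorem wedgeTrace_apply (L : 𝔼 →L[ℝ] Cov 𝔼) :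
    wedgeTrace n L = ∑ i, ExteriorAlgebra.ι ℝ (dxBasis n i) * L (EuclideanSpace.single i 1) := by
  simp [wedgeTrace]

theorem sum_component (w : 𝔼 → Cov 𝔼) (y : 𝔼) :
    ∑ I, component w I y • dxBasisExt n I = w y :=
  (dxBasisExt n).sum_repr (w y)

theorem contDiffOn_iff_component {w : 𝔼 → Cov 𝔼} {s : Set 𝔼} {k : WithTop ℕ∞} :
    ContDiffOn ℝ k w s ↔ ∀ I, ContDiffOn ℝ k (component w I) s := by
  refine ⟨fun h I => contDiffOn_linear ((dxBasisExt n).coord I) h, fun h => ?_⟩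
  have : w = fun y => ∑ I, component w I y • dxBasisExt n I :=
    funext fun y => (sum_component w y).symm
  rw [this]
  exact ContDiffOn.sum fun I _ => (h I).smul contDiffOn_const

theorem fderiv_component {w : 𝔼 → Cov 𝔼} {y : 𝔼} (hw : DifferentiableAt ℝ w y)
    (I : Finset (Fin n)) (v : 𝔼) :
    fderiv ℝ (component w I) y v = (dxBasisExt n).repr (fderiv ℝ w y v) I := by
  have h := ((LinearMap.toContinuousLinearMap ((dxBasisExt n).coord I)).hasFDerivAt.comp y
    hw.hasFDerivAt).fderiv
  have h2 : component w I = LinearMap.toContinuousLinearMap ((dxBasisExt n).coord I) ∘ w := rfl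
  rw [h2, h]
  rfl

/-- Replaces partial derivatives of components by the Fréchet derivative, so that sum, product and
chain rules apply directly. -/
theorem extDerivEuc_eq {w : 𝔼 → Cov 𝔼} {y : 𝔼} (hw : DifferentiableAt ℝ w y) :
    extDerivEuc w y = wedgeTrace n (fderiv ℝ w y) := by
  rw [extDerivEuc, Finset.sum_comm, wedgeTrace_apply]
  refine Finset.sum_congr rfl fun i _ => ?_
  rw [← (dxBasisExt n).sum_repr (fderiv ℝ w y (EuclideanSpace.single i 1)), Finset.mul_sum]
  refine Finset.sum_congr rfl fun I _ => ?_
  rw [fderiv_component hw, mul_smul_comm]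

theorem extDerivEuc_congr {w w' : 𝔼 → Cov 𝔼} {y : 𝔼} (h : w =ᶠ[nhds y] w') :
    extDerivEuc w y = extDerivEuc w' y := by
  have : ∀ I, component w I =ᶠ[nhds y] component w' I := fun I => by
    filter_upwards [h] with z hz
    simp only [component, hz]
  refine Finset.sum_congr rfl fun I _ => Finset.sum_congr rfl fun i _ => ?_
  rw [(this I).fderiv_eq]

theorem extDerivEuc_add {w w' : 𝔼 → Cov 𝔼} {y : 𝔼} (hw : DifferentiableAt ℝ w y)
    (hw' : DifferentiableAt ℝ w' y) :
    extDerivEuc (w + w') y = extDerivEuc w y + extDerivEuc w' y := by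
  rw [extDerivEuc_eq hw, extDerivEuc_eq hw', extDerivEuc_eq (hw.add hw'), fderiv_add hw hw',
    map_add]

theorem extDerivEuc_linear {w : 𝔼 → Cov 𝔼} {y : 𝔼} (hw : DifferentiableAt ℝ w y)
    (T : Cov 𝔼 →ₗ[ℝ] Cov 𝔼) :
    DifferentiableAt ℝ (fun z => T (w z)) y ∧ extDerivEuc (fun z => T (w z)) y =
      ∑ i, ExteriorAlgebra.ι ℝ (dxBasis n i) * T (fderiv ℝ w y (EuclideanSpace.single i 1)) := by
  have h := (LinearMap.toContinuousLinearMap T).hasFDerivAt.comp y hw.hasFDerivAt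
  refine ⟨h.differentiableAt, ?_⟩
  have h2 : (fun z => T (w z)) = LinearMap.toContinuousLinearMap T ∘ w := rfl
  rw [h2, extDerivEuc_eq h.differentiableAt, h.fderiv, wedgeTrace_apply]
  rfl

theorem extDerivEuc_smul_const {w : 𝔼 → Cov 𝔼} {y : 𝔼} (hw : DifferentiableAt ℝ w y) (r : ℝ) :
    extDerivEuc (r • w) y = r • extDerivEuc w y := by
  rw [extDerivEuc_eq hw, extDerivEuc_eq (hw.const_smul r), fderiv_const_smul hw, map_smul]

theorem extDerivEuc_invol {w : 𝔼 → Cov 𝔼} {y : 𝔼} (hw : DifferentiableAt ℝ w y) :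
    extDerivEuc (fun z => invol _ (w z)) y = -invol _ (extDerivEuc w y) := by
  have h := (extDerivEuc_linear hw (invol (Module.Dual ℝ 𝔼)).toLinearMap).2
  simp only [AlgHom.toLinearMap_apply] at h
  rw [h, extDerivEuc_eq hw, wedgeTrace_apply, map_sum, ← Finset.sum_neg_distrib]
  refine Finset.sum_congr rfl fun i _ => ?_
  rw [map_mul, invol_ι, neg_mul, neg_neg]

theorem hasFDerivAt_extMul {w w' : 𝔼 → Cov 𝔼} {y : 𝔼} (hw : DifferentiableAt ℝ w y)
    (hw' : DifferentiableAt ℝ w' y) :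
    DifferentiableAt ℝ (w * w') y ∧ ∀ v, fderiv ℝ (w * w') y v =
      w y * fderiv ℝ w' y v + fderiv ℝ w y v * w' y := by
  have h := ((LinearMap.mul ℝ (Cov 𝔼)).toContinuousBilinearMap.hasFDerivAt_of_bilinear
    hw.hasFDerivAt hw'.hasFDerivAt)
  have h2 : (fun z => (LinearMap.mul ℝ (Cov 𝔼)).toContinuousBilinearMap (w z) (w' z)) =
    w * w' := rfl
  rw [h2] at h
  refine ⟨h.differentiableAt, fun v => ?_⟩
  rw [h.fderiv]
  rfl

theorem extDerivEuc_mul {w w' : 𝔼 → Cov 𝔼} {y : 𝔼} (hw : DifferentiableAt ℝ w y)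
    (hw' : DifferentiableAt ℝ w' y) :
    extDerivEuc (w * w') y = extDerivEuc w y * w' y + invol _ (w y) * extDerivEuc w' y := by
  obtain ⟨h1, h2⟩ := hasFDerivAt_extMul hw hw'
  rw [extDerivEuc_eq hw, extDerivEuc_eq hw', extDerivEuc_eq h1]
  simp only [wedgeTrace_apply, h2, Finset.sum_mul, Finset.mul_sum, ← Finset.sum_add_distrib]
  refine Finset.sum_congr rfl fun i _ => ?_
  -- Moving `dxⁱ` past `w y` to reach the derivative of `w'` produces the involution.
  rw [mul_add, ← mul_assoc, ← mul_assoc, ← mul_assoc, ι_mul_eq_invol_mul_ι, add_comm]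

theorem sum_dual_smul_dxBasis (l : Module.Dual ℝ 𝔼) :
    ∑ i, l (EuclideanSpace.single i 1) • dxBasis n i = l := by
  conv_rhs => rw [← (EuclideanSpace.basisFun (Fin n) ℝ).toBasis.sum_dual_apply_smul_coord l]
  simp [dxBasis]

/-- `d(∑ w_I dx^I) = ∑ dw_I ∧ dx^I`. -/
theorem extDerivEuc_eq_sum (w : 𝔼 → Cov 𝔼) (y : 𝔼) :
    extDerivEuc w y = ∑ I, ExteriorAlgebra.ι ℝ
      ((fderiv ℝ (component w I) y).toLinearMap : Module.Dual ℝ 𝔼) * dxBasisExt n I := by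
  refine Finset.sum_congr rfl fun I _ => ?_
  conv_rhs => rw [← sum_dual_smul_dxBasis (fderiv ℝ (component w I) y).toLinearMap]
  simp [map_sum, Finset.sum_mul]

theorem extDerivEuc_algebraMap {f : 𝔼 → ℝ} {y : 𝔼} (hf : DifferentiableAt ℝ f y) :
    DifferentiableAt ℝ (fun z => algebraMap ℝ (Cov 𝔼) (f z)) y ∧
    extDerivEuc (fun z => algebraMap ℝ (Cov 𝔼) (f z)) y =
      ExteriorAlgebra.ι ℝ ((fderiv ℝ f y).toLinearMap : Module.Dual ℝ 𝔼) := by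
  have h := (LinearMap.toContinuousLinearMap
    (Algebra.linearMap ℝ (Cov 𝔼))).hasFDerivAt.comp y hf.hasFDerivAt
  refine ⟨h.differentiableAt, ?_⟩
  have h2 : (fun z => algebraMap ℝ (Cov 𝔼) (f z)) =
    LinearMap.toContinuousLinearMap (Algebra.linearMap ℝ (Cov 𝔼)) ∘ f := rfl
  rw [h2, extDerivEuc_eq h.differentiableAt, h.fderiv, wedgeTrace_apply]
  conv_rhs => rw [← sum_dual_smul_dxBasis (fderiv ℝ f y).toLinearMap]
  rw [map_sum]
  refine Finset.sum_congr rfl fun i _ => ?_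
  rw [map_smul]
  simp [Algebra.algebraMap_eq_smul_one]

theorem extDerivEuc_smul {f : 𝔼 → ℝ} {w : 𝔼 → Cov 𝔼} {y : 𝔼} (hf : DifferentiableAt ℝ f y)
    (hw : DifferentiableAt ℝ w y) :
    extDerivEuc (f • w) y = ExteriorAlgebra.ι ℝ
      ((fderiv ℝ f y).toLinearMap : Module.Dual ℝ 𝔼) * w y + f y • extDerivEuc w y := by
  obtain ⟨h1, h2⟩ := extDerivEuc_algebraMap hf
  have h := extDerivEuc_mul h1 hw
  have e : (fun z => algebraMap ℝ (Cov 𝔼) (f z)) * w = f • w :=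
    funext fun z => (Algebra.smul_def (f z) (w z)).symm
  rw [e, h2, AlgHom.commutes, ← Algebra.smul_def] at h
  exact h

theorem contDiffOn_extDerivEuc {w : 𝔼 → Cov 𝔼} {s : Set 𝔼} (hs : IsOpen s)
    (hw : ContDiffOn ℝ ∞ w s) : ContDiffOn ℝ ∞ (extDerivEuc w) s := by
  refine ContDiffOn.sum fun I _ => ContDiffOn.sum fun i _ => ?_
  have h := ((contDiffOn_iff_component.1 hw I).fderiv_of_isOpen hs (m := ∞) (by simp)).clm_apply
    (contDiffOn_const (c := EuclideanSpace.single i (1 : ℝ)))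
  exact h.smul contDiffOn_const

/-! ### Pullback -/

/-- The pullback of a form on a Euclidean space. -/
def pullback (φ : 𝔼 → 𝔼) (w : 𝔼 → Cov 𝔼) (y : 𝔼) : Cov 𝔼 :=
  ExteriorAlgebra.map (fderiv ℝ φ y).toLinearMap.dualMap (w (φ y))

theorem pullback_mul (φ : 𝔼 → 𝔼) (w w' : 𝔼 → Cov 𝔼) :
    pullback φ (w * w') = pullback φ w * pullback φ w' :=
  funext fun _ => map_mul _ _ _

theorem pullback_add (φ : 𝔼 → 𝔼) (w w' : 𝔼 → Cov 𝔼) :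
    pullback φ (w + w') = pullback φ w + pullback φ w' :=
  funext fun _ => map_add _ _ _

theorem extDerivEuc_const (c : Cov 𝔼) (y : 𝔼) : extDerivEuc (fun _ => c) y = 0 := by
  rw [extDerivEuc_eq (differentiableAt_const c), fderiv_const_apply, map_zero]

/-- A symmetric array is paired with the antisymmetric products `dxⁱ ∧ dxʲ`: swapping indices shows
the sum equals its own negative. -/
theorem sum_symm_mul_ι_eq_zero (s : Fin n → Fin n → ℝ) (hs : ∀ i j, s i j = s j i) :
    ∑ i, ExteriorAlgebra.ι ℝ (dxBasis n i) *
      ExteriorAlgebra.ι ℝ (∑ j, s i j • dxBasis n j) = 0 := by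
  have h : ∑ i, ExteriorAlgebra.ι ℝ (dxBasis n i) *
      ExteriorAlgebra.ι ℝ (∑ j, s i j • dxBasis n j) = ∑ i, ∑ j, s i j •
      (ExteriorAlgebra.ι ℝ (dxBasis n i) * ExteriorAlgebra.ι ℝ (dxBasis n j)) := by
    simp only [map_sum, map_smul, Finset.mul_sum, mul_smul_comm]
  rw [h]
  have h2 : ∀ i j, ExteriorAlgebra.ι ℝ (dxBasis n i) * ExteriorAlgebra.ι ℝ (dxBasis n j) =
      -(ExteriorAlgebra.ι ℝ (dxBasis n j) * ExteriorAlgebra.ι ℝ (dxBasis n i)) := fun i j =>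
    eq_neg_of_add_eq_zero_left (ExteriorAlgebra.ι_add_mul_swap _ _)
  have : IsAddTorsionFree (Cov 𝔼) := .of_module_rat _
  rw [← self_eq_neg]
  conv_rhs => rw [Finset.sum_comm]
  simp only [← Finset.sum_neg_distrib]
  refine Finset.sum_congr rfl fun i _ => Finset.sum_congr rfl fun j _ => ?_
  rw [hs, h2, smul_neg]

/-- For a covector this is `d(dφʲ) = 0`, the symmetry of second derivatives; products follow from
the Leibniz rule, whose differentiability hypotheses are why that claim is part of the induction. -/
theorem extDerivEuc_pullback_const {φ : 𝔼 → 𝔼} {y : 𝔼} (hφ : ContDiffAt ℝ ∞ φ y) (c : Cov 𝔼) :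
    DifferentiableAt ℝ (pullback φ fun _ => c) y ∧
      extDerivEuc (pullback φ fun _ => c) y = 0 := by
  induction c using ExteriorAlgebra.induction with
  | algebraMap r =>
    have e : (pullback φ fun _ => algebraMap ℝ (Cov 𝔼) r) = fun _ => algebraMap ℝ (Cov 𝔼) r :=
      funext fun z => AlgHom.commutes _ r
    rw [e]
    exact ⟨differentiableAt_const _, extDerivEuc_const _ _⟩
  | ι l =>
    have hd : DifferentiableAt ℝ (fderiv ℝ φ) y :=
      (hφ.fderiv_right (m := 1) (by norm_cast)).differentiableAt (by simp)
    -- `T L = ι (l ∘ L)`, so the pulled-back covector is a fixed linear map applied to the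
    -- derivative of `φ`.
    let T : (𝔼 →L[ℝ] 𝔼) →ₗ[ℝ] Cov 𝔼 := ExteriorAlgebra.ι ℝ ∘ₗ
      (LinearMap.compRight ℝ l) ∘ₗ ContinuousLinearMap.coeLM ℝ
    have e : (pullback φ fun _ => ExteriorAlgebra.ι ℝ l) =
        LinearMap.toContinuousLinearMap T ∘ fderiv ℝ φ := by
      funext z
      simp only [pullback, ExteriorAlgebra.map_apply_ι]
      rfl
    have h := (LinearMap.toContinuousLinearMap T).hasFDerivAt.comp y hd.hasFDerivAt
    rw [e]
    refine ⟨h.differentiableAt, ?_⟩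
    rw [extDerivEuc_eq h.differentiableAt, h.fderiv, wedgeTrace_apply]
    have hsymm : IsSymmSndFDerivAt ℝ φ y := hφ.isSymmSndFDerivAt (by simp; norm_cast)
    rw [← sum_symm_mul_ι_eq_zero (fun i j => l (fderiv ℝ (fderiv ℝ φ) y
      (EuclideanSpace.single i 1) (EuclideanSpace.single j 1))) fun i j => by rw [hsymm.eq]]
    refine Finset.sum_congr rfl fun i _ => ?_
    congr 1
    refine congrArg (ExteriorAlgebra.ι ℝ) ?_
    exact (sum_dual_smul_dxBasis _).symm
  | mul a b ha hb =>
    have e : (pullback φ fun _ => a * b) = (pullback φ fun _ => a) * pullback φ fun _ => b :=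
      pullback_mul φ _ _
    rw [e]
    exact ⟨(hasFDerivAt_extMul ha.1 hb.1).1, by
      rw [extDerivEuc_mul ha.1 hb.1, ha.2, hb.2, zero_mul, mul_zero, add_zero]⟩
  | add a b ha hb =>
    have e : (pullback φ fun _ => a + b) = (pullback φ fun _ => a) + pullback φ fun _ => b :=
      pullback_add φ _ _
    rw [e]
    exact ⟨ha.1.add hb.1, by rw [extDerivEuc_add ha.1 hb.1, ha.2, hb.2, add_zero]⟩

theorem extDerivEuc_sum {κ : Type*} (s : Finset κ) (w : κ → 𝔼 → Cov 𝔼) {y : 𝔼}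
    (hw : ∀ k, DifferentiableAt ℝ (w k) y) :
    extDerivEuc (∑ k ∈ s, w k) y = ∑ k ∈ s, extDerivEuc (w k) y := by
  rw [extDerivEuc_eq (DifferentiableAt.sum fun k _ => hw k), fderiv_sum fun k _ => hw k, map_sum]
  exact Finset.sum_congr rfl fun k _ => (extDerivEuc_eq (hw k)).symm

/-- The exterior derivative commutes with pullback. -/
theorem extDerivEuc_pullback {φ : 𝔼 → 𝔼} {y : 𝔼} (hφ : ContDiffAt ℝ ∞ φ y) {w : 𝔼 → Cov 𝔼}
    (hw : DifferentiableAt ℝ w (φ y)) :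
    extDerivEuc (pullback φ w) y = pullback φ (extDerivEuc w) y := by
  have hφd : DifferentiableAt ℝ φ y := hφ.differentiableAt (by simp)
  have hc : ∀ I, DifferentiableAt ℝ (component w I) (φ y) := fun I =>
    (LinearMap.toContinuousLinearMap ((dxBasisExt n).coord I)).differentiableAt.comp _ hw
  have hcφ : ∀ I, DifferentiableAt ℝ (component w I ∘ φ) y := fun I => (hc I).comp y hφd
  -- With `φ^*w = ∑ (w_I ∘ φ) φ^*dx^I` and each `φ^*dx^I` closed, only the chain rule for the
  -- coefficients remains.
  have e : pullback φ w =
      ∑ I, (component w I ∘ φ) • pullback φ fun _ => dxBasisExt n I := by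
    funext z
    simp only [pullback, Finset.sum_apply, Pi.smul_apply', Function.comp_apply]
    conv_lhs => rw [← sum_component w (φ z)]
    simp only [map_sum, map_smul]
  rw [e, extDerivEuc_sum _ _ fun I => (hcφ I).smul (extDerivEuc_pullback_const hφ _).1,
    pullback, extDerivEuc_eq_sum, map_sum]
  refine Finset.sum_congr rfl fun I _ => ?_
  rw [extDerivEuc_smul (hcφ I) (extDerivEuc_pullback_const hφ _).1,
    (extDerivEuc_pullback_const hφ _).2, smul_zero, add_zero, map_mul,
    ExteriorAlgebra.map_apply_ι, pullback, fderiv_comp _ (hc I) hφd]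
  rfl

end Calculus


/-! ### Smooth dependence of the Hodge operator on the metric. -/

section HodgeSmooth

attribute [local instance] extNorm
attribute [local instance] extNormedSpace

variable {n : ℕ}

local notation "𝔼" => EuclideanSpace ℝ (Fin n)

/-- The Gram operator `v ↦ ∑ⱼ G(v, eⱼ) eⱼ` of a bilinear form. -/
def gramOperator (G : LinearMap.BilinForm ℝ (EuclideanSpace ℝ (Fin n))) :
    EuclideanSpace ℝ (Fin n) →L[ℝ] EuclideanSpace ℝ (Fin n) :=
  LinearMap.toContinuousLinearMap
    (∑ j : Fin n, (G.flip (EuclideanSpace.single j 1)).smulRight (EuclideanSpace.single j (1 : ℝ)))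

/-- The vector with the components of a covector. -/
def dualToVec (n : ℕ) : Module.Dual ℝ (EuclideanSpace ℝ (Fin n)) →ₗ[ℝ] EuclideanSpace ℝ (Fin n) :=
  ∑ j : Fin n, (Module.Dual.eval ℝ _ (EuclideanSpace.single j (1 : ℝ))).smulRight
    (EuclideanSpace.single j (1 : ℝ))

theorem gramOperator_apply (G : LinearMap.BilinForm ℝ 𝔼) (v : 𝔼) :
    gramOperator G v =
      ∑ j, G v (EuclideanSpace.single j 1) • EuclideanSpace.single j (1 : ℝ) := by
  simp [gramOperator]

theorem dualToVec_injective : Function.Injective (dualToVec n) := by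
  rw [injective_iff_map_eq_zero]
  intro l hl
  rw [← sum_dual_smul_dxBasis l]
  refine Finset.sum_eq_zero fun i _ => ?_
  have h := congrArg (fun v : 𝔼 => v i) hl
  simp only [dualToVec, LinearMap.sum_apply, LinearMap.smulRight_apply,
    Module.Dual.eval_apply] at h
  have h' : l (EuclideanSpace.single i 1) = 0 := by simpa [Pi.single_apply] using h
  rw [h', zero_smul]

theorem gramOperator_eq (G : LinearMap.BilinForm ℝ 𝔼) (v : 𝔼) :
    gramOperator G v = dualToVec n (G v) := by
  simp [gramOperator_apply, dualToVec]

theorem gramOperator_isInvertible {G : LinearMap.BilinForm ℝ 𝔼} (hG : G.Nondegenerate) :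
    (gramOperator G).IsInvertible := by
  have hinj : Function.Injective (gramOperator G) := by
    intro v w h
    rw [gramOperator_eq, gramOperator_eq] at h
    have h2 := dualToVec_injective h
    exact (G.toDual hG).injective h2
  exact ⟨(LinearEquiv.ofInjectiveEndo _ hinj).toContinuousLinearEquiv, rfl⟩

/-- Expresses index raising by the inverse of an operator, which depends smoothly on that operator
wherever it is invertible. -/
theorem toDual_symm_eq {G : LinearMap.BilinForm ℝ 𝔼} (hG : G.Nondegenerate)
    (l : Module.Dual ℝ 𝔼) :
    (G.toDual hG).symm l = (gramOperator G).inverse (dualToVec n l) := by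
  symm
  rw [(gramOperator_isInvertible hG).inverse_apply_eq, gramOperator_eq]
  congr 1
  exact ((G.toDual hG).apply_symm_apply l).symm

/-- `hodgeStar` takes a proof of nondegeneracy, available only on `s`; hence the result is a
separate function `f` agreeing with it there. The total function `inverse` supplies a formula valid
without that proof. -/
theorem contDiffOn_hodgeStar {s : Set 𝔼} {G : 𝔼 → LinearMap.BilinForm ℝ 𝔼}
    (hG : ∀ v w, ContDiffOn ℝ ∞ (fun y => G y v w) s) {η u f : 𝔼 → Cov 𝔼}
    (hη : ContDiffOn ℝ ∞ η s) (hu : ContDiffOn ℝ ∞ u s)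
    (hf : ∀ y ∈ s, ∃ h : (G y).Nondegenerate, f y = hodgeStar (G y) h (η y) (u y)) :
    ContDiffOn ℝ ∞ f s := by
  have hgram : ContDiffOn ℝ ∞ (fun y => gramOperator (G y)) s := by
    rw [contDiffOn_clm_apply]
    intro v
    simp only [gramOperator_apply]
    exact ContDiffOn.sum fun j _ => (hG v _).smul contDiffOn_const
  have hinv : ContDiffOn ℝ ∞ (fun y => (gramOperator (G y)).inverse) s := by
    intro y hy
    obtain ⟨h, -⟩ := hf y hy
    exact (gramOperator_isInvertible h).contDiffAt_map_inverse.comp_contDiffWithinAt y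
      (hgram y hy)
  let R : 𝔼 → Module.Dual ℝ 𝔼 →ₗ[ℝ] 𝔼 := fun y =>
    (gramOperator (G y)).inverse.toLinearMap ∘ₗ dualToVec n
  have hR : ∀ l, ContDiffOn ℝ ∞ (fun y => ExteriorAlgebra.ι ℝ (R y l)) s := fun l =>
    contDiffOn_linear (ExteriorAlgebra.ι ℝ) (hinv.clm_apply contDiffOn_const)
  have hc : ContDiffOn ℝ ∞
      (fun y => contraction 𝔼 (ExteriorAlgebra.map (R y) (u y)) (η y)) s :=
    contDiffOn_bilinear (contraction 𝔼).toLinearMap (contDiffOn_map hR hu) hη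
  refine hc.congr fun y hy => ?_
  obtain ⟨h, e⟩ := hf y hy
  rw [e, hodgeStar_apply, raise]
  congr 4
  exact LinearMap.ext fun l => toDual_symm_eq h l

end HodgeSmooth

/-! ### Coordinate expressions of forms and change of charts. -/

section Charts

attribute [local instance] extNorm
attribute [local instance] extNormedSpace

variable {n : ℕ} {M : Type*} [TopologicalSpace M] [ChartedSpace (EuclideanSpace ℝ (Fin n)) M]

local notation "𝔼" => EuclideanSpace ℝ (Fin n)

theorem chartRep_mul (α β : Form n M) (x₀ : M) :
    chartRep (α * β) x₀ = chartRep α x₀ * chartRep β x₀ :=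
  funext fun _ => map_mul _ _ _

theorem chartRep_add (α β : Form n M) (x₀ : M) :
    chartRep (α + β) x₀ = chartRep α x₀ + chartRep β x₀ :=
  funext fun _ => map_add _ _ _

theorem chartRep_smul (r : ℝ) (α : Form n M) (x₀ : M) :
    chartRep (r • α) x₀ = r • chartRep α x₀ :=
  funext fun y => map_smul (ExteriorAlgebra.map (frame x₀ y).dualMap) r _

/-- The grade involution on forms. -/
def involForm (α : Form n M) : Form n M := fun x => invol _ (α x)

theorem chartRep_involForm (α : Form n M) (x₀ : M) :
    chartRep (involForm α) x₀ = fun y => invol _ (chartRep α x₀ y) :=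
  funext fun _ => (invol_map _ _).symm

theorem isSmooth_iff {α : Form n M} : α.IsSmooth ↔ ∀ x₀,
    ContDiffOn ℝ ∞ (chartRep α x₀) (extChartAt (𝓡 n) x₀).target := by
  simp only [Form.IsSmooth, contDiffOn_iff_component]

theorem Form.IsSmooth.add {α β : Form n M} (hα : α.IsSmooth) (hβ : β.IsSmooth) :
    (α + β).IsSmooth := by
  rw [isSmooth_iff] at *
  intro x₀
  rw [chartRep_add]
  exact (hα x₀).add (hβ x₀)

theorem Form.IsSmooth.smul {α : Form n M} (hα : α.IsSmooth) (r : ℝ) : (r • α).IsSmooth := by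
  rw [isSmooth_iff] at *
  intro x₀
  rw [chartRep_smul]
  exact contDiffOn_const.smul (hα x₀)

theorem Form.IsSmooth.mul {α β : Form n M} (hα : α.IsSmooth) (hβ : β.IsSmooth) :
    (α * β).IsSmooth := by
  rw [isSmooth_iff] at *
  intro x₀
  rw [chartRep_mul]
  exact contDiffOn_extMul (hα x₀) (hβ x₀)

theorem Form.IsSmooth.involForm {α : Form n M} (hα : α.IsSmooth) : (involForm α).IsSmooth := by
  rw [isSmooth_iff] at *
  intro x₀
  rw [chartRep_involForm]
  exact contDiffOn_linear (invol _).toLinearMap (hα x₀)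

theorem isOpen_target (x₀ : M) : IsOpen (extChartAt (𝓡 n) x₀).target :=
  isOpen_extChartAt_target x₀

theorem Form.IsSmooth.differentiableAt {α : Form n M} (hα : α.IsSmooth) {x₀ : M} {y : 𝔼}
    (hy : y ∈ (extChartAt (𝓡 n) x₀).target) : DifferentiableAt ℝ (chartRep α x₀) y :=
  ((isSmooth_iff.1 hα x₀).contDiffAt ((isOpen_target x₀).mem_nhds hy)).differentiableAt (by simp)

/-- The transition map between two charts. -/
def transition (x₀ x : M) : EuclideanSpace ℝ (Fin n) → EuclideanSpace ℝ (Fin n) :=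
  extChartAt (𝓡 n) x ∘ (extChartAt (𝓡 n) x₀).symm

theorem isOpen_transition_source (x₀ x : M) :
    IsOpen ((extChartAt (𝓡 n) x₀).symm ≫ extChartAt (𝓡 n) x).source := by
  rw [PartialEquiv.trans_source, PartialEquiv.symm_source]
  exact (continuousOn_extChartAt_symm x₀).isOpen_inter_preimage (isOpen_target x₀)
    (isOpen_extChartAt_source x)

variable [IsManifold (𝓡 n) ∞ M]

theorem isManifold_one : IsManifold (𝓡 n) 1 M := IsManifold.of_le (n := ∞) (by norm_cast)

theorem mdifferentiableAt_extChartAt_symm {x₀ : M} {y : 𝔼}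
    (hy : y ∈ (extChartAt (𝓡 n) x₀).target) :
    MDifferentiableAt (𝓡 n) (𝓡 n) (extChartAt (𝓡 n) x₀).symm y := by
  have := isManifold_one (n := n) (M := M)
  have h := mdifferentiableWithinAt_extChartAt_symm hy
  rw [ModelWithCorners.range_eq_univ] at h
  exact mdifferentiableWithinAt_univ.1 h

theorem mdifferentiableAt_extChartAt_of_mem {x₀ x : M} (hx : x ∈ (extChartAt (𝓡 n) x₀).source) :
    MDifferentiableAt (𝓡 n) (𝓡 n) (extChartAt (𝓡 n) x₀) x := by
  have := isManifold_one (n := n) (M := M)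
  exact mdifferentiableAt_extChartAt (by rwa [extChartAt_source] at hx)

/-- The coordinate frame on the target of a chart, as an isomorphism. -/
def frameEquiv {x₀ : M} {y : EuclideanSpace ℝ (Fin n)} (hy : y ∈ (extChartAt (𝓡 n) x₀).target) :
    EuclideanSpace ℝ (Fin n) ≃ₗ[ℝ] TangentSpace (𝓡 n) ((extChartAt (𝓡 n) x₀).symm y) :=
  have := isManifold_one (n := n) (M := M)
  LinearEquiv.ofLinearMap (frame x₀ y)
    (mfderiv (𝓡 n) (𝓡 n) (extChartAt (𝓡 n) x₀) ((extChartAt (𝓡 n) x₀).symm y)).toLinearMap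
    (by
      have h := mfderivWithin_extChartAt_symm_comp_mfderiv_extChartAt hy
      rw [ModelWithCorners.range_eq_univ, mfderivWithin_univ] at h
      exact congrArg ContinuousLinearMap.toLinearMap h)
    (by
      have h := mfderiv_extChartAt_comp_mfderivWithin_extChartAt_symm hy
      rw [ModelWithCorners.range_eq_univ, mfderivWithin_univ] at h
      exact congrArg ContinuousLinearMap.toLinearMap h)

/-- Forms with the same coordinate expressions are equal. -/
theorem Form.ext_chartRep {α β : Form n M}
    (h : ∀ (x₀ : M), ∀ y ∈ (extChartAt (𝓡 n) x₀).target, chartRep α x₀ y = chartRep β x₀ y) :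
    α = β := by
  funext x
  obtain ⟨x₀, y, hy, rfl⟩ : ∃ x₀ : M, ∃ y ∈ (extChartAt (𝓡 n) x₀).target,
      (extChartAt (𝓡 n) x₀).symm y = x :=
    ⟨x, _, mem_extChartAt_target x, extChartAt_to_inv x⟩
  -- The frame is an isomorphism, so pullback along it has a left inverse and loses nothing.
  refine ExteriorAlgebra.map_injective (f := (frameEquiv hy).toLinearMap.dualMap)
    ⟨(frameEquiv hy).symm.toLinearMap.dualMap, ?_⟩ (h x₀ y hy)
  ext l v
  exact congrArg l ((frameEquiv hy).apply_symm_apply v)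

theorem contDiffAt_transition {x₀ x : M} {y : 𝔼} (hy : y ∈ (extChartAt (𝓡 n) x₀).target)
    (hx : (extChartAt (𝓡 n) x₀).symm y ∈ (extChartAt (𝓡 n) x).source) :
    ContDiffAt ℝ ∞ (transition x₀ x) y :=
  (contDiffOn_ext_coord_change x x₀).contDiffAt
    ((isOpen_transition_source x₀ x).mem_nhds ⟨hy, hx⟩)

theorem fderiv_transition {x₀ x : M} {y : 𝔼} (hy : y ∈ (extChartAt (𝓡 n) x₀).target)
    (hx : (extChartAt (𝓡 n) x₀).symm y ∈ (extChartAt (𝓡 n) x).source) :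
    fderiv ℝ (transition x₀ x) y =
      (mfderiv (𝓡 n) (𝓡 n) (extChartAt (𝓡 n) x) ((extChartAt (𝓡 n) x₀).symm y)).comp
        (mfderiv (𝓡 n) (𝓡 n) (extChartAt (𝓡 n) x₀).symm y) := by
  rw [← mfderiv_comp y (mdifferentiableAt_extChartAt_of_mem hx)
    (mdifferentiableAt_extChartAt_symm hy), ← mfderiv_eq_fderiv]
  rfl

/-- Chain rule for the identity, valid near `y`, that the transition followed by the inverse chart
at `x` is the inverse chart at `x₀`. The two base points are only propositionally equal, so all
tangent spaces are read as `𝔼`. -/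
theorem frame_comp_fderiv_transition {x₀ x : M} {y : 𝔼}
    (hy : y ∈ (extChartAt (𝓡 n) x₀).target)
    (hx : (extChartAt (𝓡 n) x₀).symm y ∈ (extChartAt (𝓡 n) x).source) :
    ((mfderiv (𝓡 n) (𝓡 n) (extChartAt (𝓡 n) x).symm (transition x₀ x y) : 𝔼 →L[ℝ] 𝔼).comp
      (fderiv ℝ (transition x₀ x) y) : 𝔼 →L[ℝ] 𝔼) =
      (mfderiv (𝓡 n) (𝓡 n) (extChartAt (𝓡 n) x₀).symm y : 𝔼 →L[ℝ] 𝔼) := by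
  have hd : MDifferentiableAt (𝓡 n) (𝓡 n) (transition x₀ x) y :=
    ((contDiffAt_transition hy hx).differentiableAt (by simp)).mdifferentiableAt
  have ht : transition x₀ x y ∈ (extChartAt (𝓡 n) x).target := (extChartAt (𝓡 n) x).map_source hx
  have h := mfderiv_comp y (mdifferentiableAt_extChartAt_symm ht) hd
  rw [mfderiv_eq_fderiv] at h
  refine Eq.trans h.symm ?_
  apply Filter.EventuallyEq.mfderiv_eq
  filter_upwards [(isOpen_transition_source x₀ x).mem_nhds ⟨hy, hx⟩] with z hz
  exact (extChartAt (𝓡 n) x).left_inv hz.2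

theorem chartRep_eq_pullback (α : Form n M) {x₀ x : M} {y : 𝔼}
    (hy : y ∈ (extChartAt (𝓡 n) x₀).target)
    (hx : (extChartAt (𝓡 n) x₀).symm y ∈ (extChartAt (𝓡 n) x).source) :
    chartRep α x₀ y = pullback (transition x₀ x) (chartRep α x) y := by
  -- Viewing a form as a function into the fixed space `Cov 𝔼` avoids transport along the equality
  -- of base points.
  have key : ∀ (A : M → Cov 𝔼) (p q : M) (F F' : Module.Dual ℝ 𝔼 →ₗ[ℝ] Module.Dual ℝ 𝔼),
      p = q → F = F' → ExteriorAlgebra.map F (A p) = ExteriorAlgebra.map F' (A q) := by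
    rintro A p q F F' rfl rfl
    rfl
  refine (key α _ _ _ _ ((extChartAt (𝓡 n) x).left_inv hx).symm ?_).trans
    (map_map (frame x (transition x₀ x y)).dualMap (fderiv ℝ (transition x₀ x) y).toLinearMap.dualMap
      (α ((extChartAt (𝓡 n) x).symm (transition x₀ x y)))).symm
  have h := congrArg (fun L : 𝔼 →L[ℝ] 𝔼 => L.toLinearMap.dualMap)
    (frame_comp_fderiv_transition hy hx)
  exact h.symm

/-- Chart independence of `d`. At the point over `y`, `extD` uses the chart centred there; coframe
after frame is the derivative of the transition map, so naturality under pullback gives the result.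
-/
theorem chartRep_extD {α : Form n M} (hα : α.IsSmooth) {x₀ : M} {y : 𝔼}
    (hy : y ∈ (extChartAt (𝓡 n) x₀).target) :
    chartRep (extD α) x₀ y = extDerivEuc (chartRep α x₀) y := by
  set x := (extChartAt (𝓡 n) x₀).symm y with hx_def
  have hx : (extChartAt (𝓡 n) x₀).symm y ∈ (extChartAt (𝓡 n) x).source :=
    mem_extChartAt_source x
  have h1 : chartRep (extD α) x₀ y =
      pullback (transition x₀ x) (extDerivEuc (chartRep α x)) y := by
    rw [pullback, fderiv_transition hy hx]
    exact map_map (coframe x).dualMap (frame x₀ y).dualMap _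
  have h2 : chartRep α x₀ =ᶠ[nhds y] pullback (transition x₀ x) (chartRep α x) := by
    filter_upwards [(isOpen_transition_source x₀ x).mem_nhds ⟨hy, hx⟩] with z hz
    exact chartRep_eq_pullback α hz.1 hz.2
  rw [h1, extDerivEuc_congr h2, extDerivEuc_pullback (contDiffAt_transition hy hx)]
  exact hα.differentiableAt ((extChartAt (𝓡 n) x).map_source hx)

end Charts


/-! ### Smoothness and the algebraic rules of `d` on the manifold. -/

section Smoothness

attribute [local instance] extNorm
attribute [local instance] extNormedSpace

variable {n : ℕ} {M : Type*} [TopologicalSpace M] [ChartedSpace (EuclideanSpace ℝ (Fin n)) M]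
  [IsManifold (𝓡 n) ∞ M]

local notation "𝔼" => EuclideanSpace ℝ (Fin n)

theorem Form.IsSmooth.extD {α : Form n M} (hα : α.IsSmooth) : (extD α).IsSmooth := by
  rw [isSmooth_iff] at *
  exact fun x₀ => (contDiffOn_extDerivEuc (isOpen_target x₀) (hα x₀)).congr fun y hy =>
    chartRep_extD (isSmooth_iff.2 hα) hy

theorem Form.IsSmooth.star (g : PseudoRiemannianMetric n M) {η α : Form n M} (hη : η.IsSmooth)
    (hα : α.IsSmooth) : (g.star η α).IsSmooth := by
  rw [isSmooth_iff] at *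
  intro x₀
  -- The metric in coordinates, which makes the frame an isometry.
  let G : 𝔼 → LinearMap.BilinForm ℝ 𝔼 := fun y =>
    (g.val ((extChartAt (𝓡 n) x₀).symm y)).compl₁₂ (frame x₀ y) (frame x₀ y)
  refine contDiffOn_hodgeStar (G := G) (g.smooth x₀) (hη x₀) (hα x₀) fun y hy => ?_
  have hG : (G y).Nondegenerate := LinearMap.BilinForm.Nondegenerate.congr (frameEquiv hy).symm
    (g.nondegenerate ((extChartAt (𝓡 n) x₀).symm y))
  exact ⟨hG, hodgeStar_map (frameEquiv hy) _ (g.nondegenerate _) (G y) hG (fun _ _ => rfl) _ _⟩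

/-- The sign is the scalar part of the smooth form `∗η`, and pullback preserves scalar parts; local
constancy need not be established. -/
theorem Form.IsSmooth.sign_smul {g : PseudoRiemannianMetric n M} (η : VolumeElement g)
    {α : Form n M} (hα : α.IsSmooth) : Form.IsSmooth (fun x => η.sign x • α x) := by
  have hη := Form.IsSmooth.star g η.smooth η.smooth
  rw [isSmooth_iff] at *
  intro x₀
  have h : chartRep (fun x => η.sign x • α x) x₀ = fun y =>
      ExteriorAlgebra.algebraMapInv (chartRep (g.star η.form η.form) x₀ y) • chartRep α x₀ y := by
    funext y
    refine (map_smul (ExteriorAlgebra.map (frame x₀ y).dualMap) _ _).trans ?_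
    congr 1
    exact (algebraMapInv_map _ _).symm
  rw [h]
  have h' : ContDiffOn ℝ ∞ (fun y => ExteriorAlgebra.algebraMapInv
      (chartRep (g.star η.form η.form) x₀ y)) (extChartAt (𝓡 n) x₀).target :=
    contDiffOn_linear ExteriorAlgebra.algebraMapInv.toLinearMap (hη x₀)
  exact h'.smul (hα x₀)

theorem extD_add {α β : Form n M} (hα : α.IsSmooth) (hβ : β.IsSmooth) :
    extD (α + β) = extD α + extD β := by
  refine Form.ext_chartRep fun x₀ y hy => ?_
  rw [chartRep_extD (hα.add hβ) hy, chartRep_add, chartRep_add, Pi.add_apply,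
    chartRep_extD hα hy, chartRep_extD hβ hy,
    extDerivEuc_add (hα.differentiableAt hy) (hβ.differentiableAt hy)]

theorem extD_smul (r : ℝ) {α : Form n M} (hα : α.IsSmooth) : extD (r • α) = r • extD α := by
  refine Form.ext_chartRep fun x₀ y hy => ?_
  rw [chartRep_extD (hα.smul r) hy, chartRep_smul, chartRep_smul, Pi.smul_apply,
    chartRep_extD hα hy, extDerivEuc_smul_const (hα.differentiableAt hy)]

theorem extD_involForm {α : Form n M} (hα : α.IsSmooth) :
    extD (involForm α) = (-1 : ℝ) • involForm (extD α) := by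
  refine Form.ext_chartRep fun x₀ y hy => ?_
  rw [chartRep_extD hα.involForm hy, chartRep_smul, chartRep_involForm, chartRep_involForm,
    Pi.smul_apply, chartRep_extD hα hy, extDerivEuc_invol (hα.differentiableAt hy), neg_one_smul]

/-- The graded Leibniz rule. -/
theorem extD_mul {α β : Form n M} (hα : α.IsSmooth) (hβ : β.IsSmooth) :
    extD (α * β) = extD α * β + involForm α * extD β := by
  refine Form.ext_chartRep fun x₀ y hy => ?_
  rw [chartRep_extD (hα.mul hβ) hy, chartRep_mul, chartRep_add, chartRep_mul, chartRep_mul,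
    chartRep_involForm, Pi.add_apply, Pi.mul_apply, Pi.mul_apply,
    chartRep_extD hα hy, chartRep_extD hβ hy,
    extDerivEuc_mul (hα.differentiableAt hy) (hβ.differentiableAt hy)]

end Smoothness

/-! ### The codifferential, the Schouten bracket and the Laplacian. -/

section Codifferential

variable {n : ℕ} {M : Type*} [TopologicalSpace M] [ChartedSpace (EuclideanSpace ℝ (Fin n)) M]
  {g : PseudoRiemannianMetric n M} (η : VolumeElement g)

theorem involForm_add (α β : Form n M) : involForm (α + β) = involForm α + involForm β :=
  funext fun _ => map_add _ _ _

theorem involForm_smul (r : ℝ) (α : Form n M) : involForm (r • α) = r • involForm α :=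
  funext fun x => map_smul (invol _) r (α x)

theorem involForm_eq_of_isOfDegree {a : ℕ} {α : Form n M} (h : α.IsOfDegree a) :
    involForm α = (-1 : ℝ) ^ a • α :=
  funext fun x => invol_of_mem (h x)

theorem hodge_add (ν α β : Form n M) : g.star ν (α + β) = g.star ν α + g.star ν β :=
  funext fun _ => map_add _ _ _

theorem hodge_smul (r : ℝ) (ν α : Form n M) : g.star ν (r • α) = r • g.star ν α :=
  funext fun x => map_smul (hodgeStar (g.val x) (g.nondegenerate x) (ν x)) r (α x)

/-- The Hodge operator sends degree `a` to `n - a`; the factor `(-1)^n` is the parity of `η`. -/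
theorem involForm_star (α : Form n M) :
    involForm (g.star η.form α) = (-1 : ℝ) ^ n • g.star η.form (involForm α) := by
  funext x
  have h1 := invol_hodgeStar (g.val x) (g.nondegenerate x) (η.form x) (α x)
  rw [invol_of_mem (η.degree x), hodgeStar_apply _ _ (_ • _), map_smul] at h1
  exact h1

theorem involForm_iterate_add (k : ℕ) (α β : Form n M) :
    involForm^[k] (α + β) = involForm^[k] α + involForm^[k] β := by
  induction k generalizing α β with
  | zero => rfl
  | succ k ih => simp only [Function.iterate_succ_apply, involForm_add, ih]

theorem involForm_iterate_smul (k : ℕ) (r : ℝ) (α : Form n M) :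
    involForm^[k] (r • α) = r • involForm^[k] α := by
  induction k generalizing α with
  | zero => rfl
  | succ k ih => simp only [Function.iterate_succ_apply, involForm_smul, ih]

theorem Form.IsSmooth.involForm_iterate (k : ℕ) {α : Form n M} (hα : α.IsSmooth) :
    (LeibnizLaplacian.involForm^[k] α).IsSmooth := by
  induction k generalizing α with
  | zero => exact hα
  | succ k ih => exact ih hα.involForm

theorem codiff_eq (α : Form n M) : codiff η α = fun x => η.sign x •
    g.star η.form (extD (g.star η.form (involForm^[n] α))) x := by
  have h : ∀ (k : ℕ) (α : Form n M), (fun z => CliffordAlgebra.involute^[k] (α z)) =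
      involForm^[k] α := by
    intro k
    induction k with
    | zero => exact fun _ => rfl
    | succ k ih => exact fun α => ih (involForm α)
  rw [← h]
  rfl

theorem negOnePow_smul (a : ℕ) (α : Form n M) :
    (a : ℤ).negOnePow • α = (-1 : ℝ) ^ a • α := by
  rcases Nat.even_or_odd a with h | h
  · rw [Int.negOnePow_even _ (by exact_mod_cast h), h.neg_one_pow, one_smul, one_smul]
  · rw [Int.negOnePow_odd _ (by exact_mod_cast h), h.neg_one_pow, neg_one_smul, Units.neg_smul,
      one_smul]

theorem leibnizSchouten_eq (a : ℕ) (α β : Form n M) :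
    leibnizSchouten η a α β =
      α * codiff η β + (-1 : ℝ) ^ a • (codiff η α * β - codiff η (α * β)) := by
  rw [← negOnePow_smul, leibnizSchouten, leibnizBracket, add_zero, neg_one_mul, Int.negOnePow_neg]
  rfl

theorem neg_one_pow_smul_smul (a : ℕ) (α : Form n M) :
    (-1 : ℝ) ^ a • (-1 : ℝ) ^ a • α = α := by
  rw [smul_smul, ← mul_pow]
  norm_num

theorem schouten_eq (a : ℕ) (α β : Form n M) :
    schouten η a α β = codiff η α * β + (-1 : ℝ) ^ a • (α * codiff η β) - codiff η (α * β) := by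
  rw [schouten, negOnePow_smul, leibnizSchouten_eq, smul_add, neg_one_pow_smul_smul]
  abel

theorem leibnizSchouten_eq_smul_schouten (a : ℕ) (α β : Form n M) :
    leibnizSchouten η a α β = (-1 : ℝ) ^ a • schouten η a α β := by
  rw [schouten, negOnePow_smul, neg_one_pow_smul_smul]

variable [IsManifold (𝓡 n) ∞ M]

theorem Form.IsSmooth.codiff {α : Form n M} (hα : α.IsSmooth) : (codiff η α).IsSmooth := by
  rw [codiff_eq]
  exact Form.IsSmooth.sign_smul η
    (Form.IsSmooth.star g η.smooth (Form.IsSmooth.star g η.smooth (hα.involForm_iterate n)).extD)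

theorem codiff_add {α β : Form n M} (hα : α.IsSmooth) (hβ : β.IsSmooth) :
    codiff η (α + β) = codiff η α + codiff η β := by
  rw [codiff_eq, codiff_eq, codiff_eq, involForm_iterate_add, hodge_add,
    extD_add (Form.IsSmooth.star g η.smooth (hα.involForm_iterate n))
      (Form.IsSmooth.star g η.smooth (hβ.involForm_iterate n)), hodge_add]
  exact funext fun x => smul_add _ _ _

theorem codiff_smul (r : ℝ) {α : Form n M} (hα : α.IsSmooth) :
    codiff η (r • α) = r • codiff η α := by
  rw [codiff_eq, codiff_eq, involForm_iterate_smul, hodge_smul,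
    extD_smul r (Form.IsSmooth.star g η.smooth (hα.involForm_iterate n)), hodge_smul]
  exact funext fun x => smul_comm (η.sign x) r
    (g.star η.form (extD (g.star η.form (involForm^[n] α))) x)

/-- The codifferential has odd degree. -/
theorem involForm_codiff {α : Form n M} (hα : α.IsSmooth) :
    involForm (codiff η α) = (-1 : ℝ) • codiff η (involForm α) := by
  have hs := Form.IsSmooth.star g η.smooth (hα.involForm_iterate n)
  have hs' := Form.IsSmooth.star g η.smooth (hα.involForm.involForm_iterate n)
  have h : involForm (g.star η.form (extD (g.star η.form (involForm^[n] α)))) =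
      (-1 : ℝ) • g.star η.form (extD (g.star η.form (involForm^[n] (involForm α)))) := by
    have h1 : involForm (extD (g.star η.form (involForm^[n] α))) =
        (-1 : ℝ) • extD (involForm (g.star η.form (involForm^[n] α))) := by
      rw [extD_involForm hs, smul_smul]
      norm_num
    -- The involution crosses two stars, whose factors `(-1)^n` cancel, and one `d`, which leaves
    -- the single `-1`.
    rw [involForm_star, h1, involForm_star, ← Function.iterate_succ_apply' involForm,
      Function.iterate_succ_apply, extD_smul _ hs', hodge_smul, hodge_smul, smul_smul, smul_smul]
    congr 1
    rw [mul_right_comm, ← mul_pow]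
    norm_num
  rw [codiff_eq, codiff_eq]
  funext x
  refine (map_smul (invol _) _ _).trans ?_
  refine (congrArg (η.sign x • ·) (congrFun h x)).trans ?_
  exact smul_comm (η.sign x) (-1 : ℝ)
    (g.star η.form (extD (g.star η.form (involForm^[n] (involForm α)))) x)

/-- The Laplacian measures its own deviation from the Leibniz rule through the Schouten bracket. -/
theorem laplacian_mul_defect {a : ℕ} {α β : Form n M} (hα : α.IsSmooth)
    (hαdeg : α.IsOfDegree a) (hβ : β.IsSmooth) :
    laplacian η α * β + α * laplacian η β - laplacian η (α * β) =
      schouten η (a + 1) (extD α) β + (-1 : ℝ) ^ a • schouten η a α (extD β)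
        + extD (schouten η a α β) := by
  have hinv := involForm_eq_of_isOfDegree hαdeg
  -- The sign `(-1)^(a-1)` of `δα`, written without natural subtraction so that `a = 0` is covered.
  have hinvδ : involForm (codiff η α) = (-1 : ℝ) • (-1 : ℝ) ^ a • codiff η α := by
    rw [involForm_codiff η hα, hinv, codiff_smul η _ hα]
  have hδα := hα.codiff η
  have hδβ := hβ.codiff η
  have hαβ := hα.mul hβ
  have e1 : codiff η (extD (α * β)) =
      codiff η (extD α * β) + (-1 : ℝ) ^ a • codiff η (α * extD β) := by
    rw [extD_mul hα hβ, hinv, smul_mul_assoc, codiff_add η (hα.extD.mul hβ)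
      ((hα.mul hβ.extD).smul _), codiff_smul η _ (hα.mul hβ.extD)]
  have e2 : extD (schouten η a α β) =
      extD (codiff η α) * β + (-1 : ℝ) • (-1 : ℝ) ^ a • (codiff η α * extD β)
        + (-1 : ℝ) ^ a • (extD α * codiff η β) + α * extD (codiff η β)
        - extD (codiff η (α * β)) := by
    have h : schouten η a α β = codiff η α * β + (-1 : ℝ) ^ a • (α * codiff η β)
        + (-1 : ℝ) • codiff η (α * β) := by
      rw [schouten_eq, neg_one_smul, sub_eq_add_neg]
    rw [h, extD_add ((hδα.mul hβ).add ((hα.mul hδβ).smul _)) ((hαβ.codiff η).smul _),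
      extD_add (hδα.mul hβ) ((hα.mul hδβ).smul _), extD_smul _ (hα.mul hδβ),
      extD_smul _ (hαβ.codiff η), extD_mul hδα hβ, extD_mul hα hδβ, hinv, hinvδ, smul_add,
      smul_mul_assoc, smul_mul_assoc, smul_mul_assoc, neg_one_pow_smul_smul, neg_one_smul,
      neg_one_smul]
    abel
  have e3 := schouten_eq η (a + 1) (extD α) β
  push_cast at e3
  rw [e2, e3, schouten_eq, smul_sub, smul_add, neg_one_pow_smul_smul]
  simp only [laplacian, e1, add_mul, mul_add, pow_succ, mul_neg, mul_one, neg_smul, one_smul]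
  abel

end Codifferential

end LeibnizLaplacian

end

theorem theorem4 (n : ℕ) (M : Type*) [TopologicalSpace M]
    [ChartedSpace (EuclideanSpace ℝ (Fin n)) M] [IsManifold (𝓡 n) ∞ M]
    (g : LeibnizLaplacian.PseudoRiemannianMetric n M) (η : LeibnizLaplacian.VolumeElement g)
    (a : ℕ) (α β : LeibnizLaplacian.Form n M)
    (hα : α.IsSmooth) (hαdeg : α.IsOfDegree a) (hβ : β.IsSmooth) :
    LeibnizLaplacian.leibnizBracket 0 0 (LeibnizLaplacian.laplacian η)
        (LeibnizLaplacian.wedge n M) a α β =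
      LeibnizLaplacian.leibnizBracket 1 (-1) LeibnizLaplacian.extD
        (LeibnizLaplacian.leibnizSchouten η) a α β ∧
    LeibnizLaplacian.laplacian η α * β + α * LeibnizLaplacian.laplacian η β
        - LeibnizLaplacian.laplacian η (α * β) =
      LeibnizLaplacian.schouten η (a + 1) (LeibnizLaplacian.extD α) β
        + (-1 : ℝ) ^ a • LeibnizLaplacian.schouten η a α (LeibnizLaplacian.extD β)
        + LeibnizLaplacian.extD (LeibnizLaplacian.schouten η a α β) := by
  have h := LeibnizLaplacian.laplacian_mul_defect η hα hαdeg hβ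
  refine ⟨?_, h⟩
  have hl : LeibnizLaplacian.leibnizBracket 0 0 (LeibnizLaplacian.laplacian η)
      (LeibnizLaplacian.wedge n M) a α β = LeibnizLaplacian.laplacian η α * β
        + α * LeibnizLaplacian.laplacian η β - LeibnizLaplacian.laplacian η (α * β) := by
    simp only [LeibnizLaplacian.leibnizBracket, LeibnizLaplacian.wedge, zero_mul,
      Int.negOnePow_zero, one_smul]
    abel
  -- Smoothness is needed to pull the sign relating the two brackets through `extD`.
  have hs : LeibnizLaplacian.Form.IsSmooth (LeibnizLaplacian.schouten η a α β) := by
    rw [LeibnizLaplacian.schouten_eq, sub_eq_add_neg, ← neg_one_smul ℝ]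
    exact (((hα.codiff η).mul hβ).add ((hα.mul (hβ.codiff η)).smul _)).add
      (((hα.mul hβ).codiff η).smul _)
  have e := LeibnizLaplacian.leibnizSchouten_eq_smul_schouten η (a + 1)
    (LeibnizLaplacian.extD α) β
  push_cast at e
  -- The outer sign is `(-1)^(a-1)`, as the bracket has degree `-1`. It cancels the `(-1)^(a+1)`
  -- from `{dα, β}_δ` and turns `-(-1)^a` from `d{α, β}_δ` into `+1`.
  rw [hl, h, LeibnizLaplacian.leibnizBracket, one_mul, Int.negOnePow_add, Int.negOnePow_neg,
    Int.negOnePow_one, mul_neg, mul_one, Units.neg_smul, LeibnizLaplacian.negOnePow_smul, e,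
    LeibnizLaplacian.leibnizSchouten_eq_smul_schouten,
    LeibnizLaplacian.leibnizSchouten_eq_smul_schouten, LeibnizLaplacian.extD_smul _ hs, smul_sub,
    LeibnizLaplacian.neg_one_pow_smul_smul, pow_succ, mul_neg, mul_one, neg_smul, smul_neg,
    LeibnizLaplacian.neg_one_pow_smul_smul]
  abel
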